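/- Let $R$ be an associative ring with unit and $M$ a left $R$-module. Let $\sigma[M]$ be the full subcategory of $R$-modules isomorphic to a submodule of an $M$-generated module (a quotient of a direct sum of copies of $M$). Write $N\le_e L$ when $N$ is an essential submodule of $L$. Call $N\in\sigma[M]$ $M$-singular if there is an exact sequence $0\to K\to L\to N\to 0$ in $\sigma[M]$ with $K\le_e L$. Call $M$ non-$M$-singular if $\mathcal Z(M)=0$, where $\mathcal Z(M)=\sum\{f(N) : N\ M\text{-singular},\ f\in\mathrm{Hom}_R(N,M)\}$. For $K,L\le M$ put $K_ML=\sum\{f(K) : f\in \mathrm{Hom}_R(M,L)\}$. Call $M$ semiprime if $K_MK=0$ implies $K=0$ for every fully invariant submodule $K\le M$. An annihilator in $M$ is a submodule of the form $\mathcal A_X=\bigcap_{f\in X}\mathrm{Ker}(f)$ with $X\subseteq \mathrm{End}_R(M)$. **Theorem 2.8.** Let $M$ be projective in $\sigma[M]$ (that is, every morphism from $M$ lifts along every epimorphism of $\sigma[M]$), with finite uniform dimension (that is, $M$ contains no infinite direct sum of nonzero submodules). The following conditions are equivalent: 1. $M$ is semiprime and non-$M$-singular; 2. $M$ is semiprime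 and satisfies the ascending chain condition on annihilators $\mathcal A_X$; 3. for every submodule $N\le M$, one has $N\le_e M$ if and only if there exists a monomorphism $M\to N$. -/

import Mathlib

namespace GoldieModule

universe u v

/-- The submodule `N` is essential in `M`: it meets every nonzero submodule nontrivially. -/
def IsEssential {R : Type u} [Ring R] {M : Type v} [AddCommGroup M] [Module R M]
    (N : Submodule R M) : Prop :=
  ∀ K : Submodule R M, N ⊓ K = ⊥ → K = ⊥

/-- `M` has finite uniform (Goldie) dimension: it contains no infinite direct sum of nonzero
submodules. -/
def HasFiniteUniformDim (R : Type u) [Ring R] (M : Type v) [AddCommGroup M] [Module R M] : Prop :=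
  ∀ A : ℕ → Submodule R M, iSupIndep A → ∃ n, A n = ⊥

/-- `X` is `M`-generated: there is an epimorphism onto `X` from a direct sum of copies of `M`. -/
def IsGeneratedBy (R : Type u) [Ring R] (M : Type v) [AddCommGroup M] [Module R M]
    (X : Type v) [AddCommGroup X] [Module R X] : Prop :=
  ∃ (ι : Type v) (p : (ι →₀ M) →ₗ[R] X), Function.Surjective p

/-- `N` belongs to `σ[M]`: it is isomorphic to a submodule of an `M`-generated module.

All modules are taken in the universe of `M`. This loses nothing: every cyclic module in `σ[M]`
embeds into a quotient of some `M ^ n`, so a module of `σ[M]` with a generating set that is small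
for this universe is itself small for it. -/
def InSigma (R : Type u) [Ring R] (M : Type v) [AddCommGroup M] [Module R M]
    (N : Type v) [AddCommGroup N] [Module R N] : Prop :=
  ∃ (X : Type v) (_ : AddCommGroup X) (_ : Module R X),
    IsGeneratedBy R M X ∧ ∃ j : N →ₗ[R] X, Function.Injective j

/-- `P` is projective in `σ[M]`: morphisms from `P` lift along every epimorphism of `σ[M]`. -/
def IsProjectiveInSigma (R : Type u) [Ring R] (M : Type v) [AddCommGroup M] [Module R M]
    (P : Type v) [AddCommGroup P] [Module R P] : Prop :=
  InSigma R M P ∧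
  ∀ (L N : Type v) [AddCommGroup L] [Module R L] [AddCommGroup N] [Module R N],
    InSigma R M L → InSigma R M N →
    ∀ (g : L →ₗ[R] N) (f : P →ₗ[R] N), Function.Surjective g →
      ∃ h : P →ₗ[R] L, g ∘ₗ h = f

/-- `N` is `M`-singular: `N` lies in `σ[M]` and there is an exact sequence `0 → K → L → N → 0` in
`σ[M]` in which (the image of) `K` is essential in `L`. -/
def IsSingular (R : Type u) [Ring R] (M : Type v) [AddCommGroup M] [Module R M]
    (N : Type v) [AddCommGroup N] [Module R N] : Prop :=
  InSigma R M N ∧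
  ∃ (K : Type v) (_ : AddCommGroup K) (_ : Module R K)
    (L : Type v) (_ : AddCommGroup L) (_ : Module R L)
    (i : K →ₗ[R] L) (p : L →ₗ[R] N),
    InSigma R M K ∧ InSigma R M L ∧
    Function.Injective i ∧ Function.Exact i p ∧ Function.Surjective p ∧
    IsEssential (LinearMap.range i)

/-- `𝒵(L)`: the sum of the images of all morphisms into `L` from `M`-singular modules. -/
def singularSubmodule (R : Type u) [Ring R] (M : Type v) [AddCommGroup M] [Module R M]
    (L : Type v) [AddCommGroup L] [Module R L] : Submodule R L :=
  sSup {P : Submodule R L | ∃ (N : Type v) (_ : AddCommGroup N) (_ : Module R N)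
    (f : N →ₗ[R] L), IsSingular R M N ∧ P = LinearMap.range f}

/-- `L` is non-`M`-singular: `𝒵(L) = 0`. -/
def IsNonSingular (R : Type u) [Ring R] (M : Type v) [AddCommGroup M] [Module R M]
    (L : Type v) [AddCommGroup L] [Module R L] : Prop :=
  singularSubmodule R M L = ⊥

/-- The product `K_M L = ∑ {f(K) | f ∈ Hom_R(M, L)}` of submodules of `M`. -/
def prod {R : Type u} [Ring R] {M : Type v} [AddCommGroup M] [Module R M]
    (K L : Submodule R M) : Submodule R M :=
  ⨆ f : M →ₗ[R] L, K.map (L.subtype ∘ₗ f)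

/-- `N` is a semiprime submodule of `M`: it is fully invariant, and `K_M K ≤ N` implies `K ≤ N`
for every fully invariant submodule `K`. -/
def IsSemiprimeSubmodule {R : Type u} [Ring R] {M : Type v} [AddCommGroup M] [Module R M]
    (N : Submodule R M) : Prop :=
  N.IsFullyInvariant ∧
  ∀ K : Submodule R M, K.IsFullyInvariant → prod K K ≤ N → K ≤ N

/-- `M` is a semiprime module: `0` is a semiprime submodule of `M`. -/
def IsSemiprimeModule (R : Type u) [Ring R] (M : Type v) [AddCommGroup M] [Module R M] : Prop :=
  IsSemiprimeSubmodule (⊥ : Submodule R M)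

/-- The left annihilator `𝒜_X = ⋂ {Ker f | f ∈ X}` in `M` of a set `X` of endomorphisms. -/
def leftAnnihilator {R : Type u} [Ring R] {M : Type v} [AddCommGroup M] [Module R M]
    (X : Set (Module.End R M)) : Submodule R M :=
  ⨅ f ∈ X, LinearMap.ker f

/-- `M` satisfies the ascending chain condition on left annihilators: every ascending sequence of
left annihilators in `M` becomes stationary. -/
def HasACCOnAnnihilators (R : Type u) [Ring R] (M : Type v) [AddCommGroup M] [Module R M] : Prop :=
  ∀ A : ℕ →o Submodule R M,
    (∀ n, ∃ X : Set (Module.End R M), A n = leftAnnihilator X) →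
    ∃ n, ∀ m, n ≤ m → A n = A m

end GoldieModule

/-!
Two facts carry the whole argument.

* If `M` is semiprime and projective in `σ[M]`, then every nonzero submodule `N` of `M` admits a
  morphism `g : M → N` with `g(N) ≠ 0` (`exists_hom_apply_ne_zero`): for the trace `K = ∑ s(N)`,
  `s` running through the endomorphisms, semiprimeness gives `f : M → K` with `f(K) ≠ 0`, and `f`
  lifts along the epimorphism from a direct sum of copies of `N` onto `K`.
* If `P ≤ M` is the image of an `M`-singular module, then every morphism `M → P` has essential
  kernel (`isEssential_ker_of_isSingular`), again by lifting.  Conversely, if `M` is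
  non-`M`-singular, then a morphism from a submodule of `M` to `M` with essential kernel is zero.

Finite uniform dimension enters through the well-foundedness of two relations on submodules:
"passing to a smaller submodule that misses a nonzero part" and "passing to a larger submodule by
a non-essential extension".

Non-singular implies the chain condition: annihilators have no proper essential extensions.
The chain condition implies non-singular: otherwise there is a nonzero endomorphism `a` with
essential kernel, which may be taken with `ker a` maximal. The first fact gives
`s` with `a s a ≠ 0`, so `ker (a s a) = ker a`; but the essential submodule `ker (a s)` meets the
image of `a`, a contradiction.

Non-singular implies the compressibility condition: a morphism `M → U` that is nonzero on a uniform
submodule `U` is injective on `U`.  Hence, by induction along the first relation, every submodule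
`X` admits a morphism `f : M → X` injective on `X`; when `X` is essential, `f` is injective.
Conversely, from a monomorphism `M → K ⊕ L`, with `L` a complement of `K`, the component in `K`
vanishes on `K` if `K` is fully invariant with `K_M K = 0`, and has essential kernel if `K` is
the image of an `M`-singular module; both force `K = 0`.
-/

namespace GoldieModule

universe u v

variable {R : Type u} [Ring R] {M : Type v} [AddCommGroup M] [Module R M]

/-! ### Essential submodules -/

theorem IsEssential.mono {A B : Submodule R M} (hA : IsEssential A) (h : A ≤ B) :
    IsEssential B :=
  fun K hK => hA K (le_bot_iff.1 ((inf_le_inf_right K h).trans hK.le))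

theorem IsEssential.comap {L : Type*} [AddCommGroup L] [Module R L] {A : Submodule R L}
    (hA : IsEssential A) (h : M →ₗ[R] L) : IsEssential (A.comap h) := by
  intro K hK
  have hmap : K.map h = ⊥ := by
    refine hA _ (eq_bot_iff.2 ?_)
    rintro _ ⟨hx, x, hxK, rfl⟩
    have : x ∈ A.comap h ⊓ K := ⟨hx, hxK⟩
    rw [hK, Submodule.mem_bot] at this
    simp [this]
  have hle : K ≤ A.comap h := fun x hx => by
    have : h x ∈ K.map h := ⟨x, hx, rfl⟩
    rw [hmap, Submodule.mem_bot] at this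
    simp [this]
  rwa [inf_eq_right.2 hle] at hK

/-- An injective map with essential image carries essential submodules to essential ones. -/
theorem IsEssential.map {e : Module.End R M} (he : Function.Injective e)
    (hr : IsEssential (LinearMap.range e)) {A : Submodule R M} (hA : IsEssential A) :
    IsEssential (A.map e) := by
  intro K hK
  have hcomap : K.comap e = ⊥ := by
    refine hA _ (eq_bot_iff.2 fun x hx => ?_)
    have : e x ∈ A.map e ⊓ K := ⟨⟨x, hx.1, rfl⟩, hx.2⟩
    rw [hK, Submodule.mem_bot] at this
    exact he (this.trans (map_zero e).symm)
  refine hr K (eq_bot_iff.2 ?_)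
  rintro _ ⟨⟨x, rfl⟩, hx⟩
  have : x ∈ K.comap e := hx
  rw [hcomap, Submodule.mem_bot] at this
  simp [this]

/-! ### Finite uniform dimension -/

theorem map_eq_bot_iff_of_injective {L : Type*} [AddCommGroup L] [Module R L] {f : L →ₗ[R] M}
    (hf : Function.Injective f) (K : Submodule R L) : K.map f = ⊥ ↔ K = ⊥ :=
  ⟨fun h => Submodule.map_injective_of_injective hf (h.trans (Submodule.map_bot f).symm),
    fun h => h ▸ Submodule.map_bot f⟩

theorem iSupIndep_of_forall_supIndep {ι : Type*} {Y : ι → Submodule R M}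
    (h : ∀ s : Finset ι, s.SupIndep Y) : iSupIndep Y := by
  classical
  intro i
  rw [Submodule.disjoint_def]
  intro x hx hx'
  rw [Submodule.mem_iSup_iff_exists_finset] at hx'
  obtain ⟨s, hs⟩ := hx'
  have hle : (⨆ j ∈ s, ⨆ _ : j ≠ i, Y j) ≤ (s.erase i).sup Y :=
    iSup₂_le fun j hj => iSup_le fun hji => Finset.le_sup (Finset.mem_erase.2 ⟨hji, hj⟩)
  exact Submodule.disjoint_def.1
    (h (insert i s) ((Finset.erase_subset i s).trans (Finset.subset_insert i s))
      (Finset.mem_insert_self i s) (Finset.notMem_erase i s)) x hx (hle hs)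

/-- In a module of finite uniform dimension, one cannot pass infinitely often to a submodule that
misses a nonzero part of the previous one. -/
theorem HasFiniteUniformDim.wellFounded_down (hfin : HasFiniteUniformDim R M) :
    WellFounded fun X' X : Submodule R M => X' ≤ X ∧ ∃ Y ≤ X, Y ≠ ⊥ ∧ Disjoint Y X' := by
  rw [wellFounded_iff_isEmpty_descending_chain]
  refine ⟨fun ⟨X, hX⟩ => ?_⟩
  choose hle Y hYX hY hd using hX
  have hanti : Antitone X := antitone_nat_of_succ_le hle
  obtain ⟨n, hn⟩ := hfin Y (iSupIndep_of_forall_supIndep fun s => by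
    induction s using Finset.induction_on_min with
    | empty => exact Finset.supIndep_empty Y
    | insert a s has ih =>
      exact ih.insert ((hd a).mono_right
        (Finset.sup_le fun b hb => (hYX b).trans (hanti (has b hb)))))
  exact hY n hn

/-- In a module of finite uniform dimension, there is no infinite chain of non-essential
extensions. -/
theorem HasFiniteUniformDim.wellFounded_up (hfin : HasFiniteUniformDim R M) :
    WellFounded fun B A : Submodule R M => A ≤ B ∧ ∃ Y ≤ B, Y ≠ ⊥ ∧ Disjoint Y A := by
  rw [wellFounded_iff_isEmpty_descending_chain]
  refine ⟨fun ⟨X, hX⟩ => ?_⟩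
  choose hle Y hYX hY hd using hX
  have hmono : Monotone X := monotone_nat_of_le_succ hle
  obtain ⟨n, hn⟩ := hfin Y (iSupIndep_of_forall_supIndep fun s => by
    induction s using Finset.induction_on_max with
    | empty => exact Finset.supIndep_empty Y
    | insert a s has ih =>
      exact ih.insert ((hd a).mono_right
        (Finset.sup_le fun b hb => (hYX b).trans (hmono (has b hb)))))
  exact hY n hn

theorem HasFiniteUniformDim.exists_complement (hfin : HasFiniteUniformDim R M)
    (K : Submodule R M) : ∃ L, Disjoint K L ∧ IsEssential (K ⊔ L) := by
  obtain ⟨L, hL, hmax⟩ := hfin.wellFounded_up.has_min {L | Disjoint K L} ⟨⊥, disjoint_bot_right⟩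
  refine ⟨L, hL, fun Y hY => ?_⟩
  by_contra hne
  have hd : Disjoint (K ⊔ L) Y := disjoint_iff.2 hY
  exact hmax (L ⊔ Y) (hL.disjoint_sup_right_of_disjoint_sup_left hd)
    ⟨le_sup_left, Y, le_sup_right, hne, (hd.mono_left le_sup_right).symm⟩

/-- `U` is uniform: it is nonzero and any two nonzero submodules of it intersect nontrivially. -/
def IsUniformSubmodule (U : Submodule R M) : Prop :=
  U ≠ ⊥ ∧ ∀ A B : Submodule R M, A ≤ U → B ≤ U → Disjoint A B → A = ⊥ ∨ B = ⊥

theorem HasFiniteUniformDim.exists_uniform (hfin : HasFiniteUniformDim R M) (X : Submodule R M)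
    (hX : X ≠ ⊥) : ∃ U ≤ X, IsUniformSubmodule U := by
  induction X using hfin.wellFounded_down.induction with
  | _ X ih =>
    by_cases hU : IsUniformSubmodule X
    · exact ⟨X, le_rfl, hU⟩
    · simp only [IsUniformSubmodule, not_and, not_forall, not_or] at hU
      obtain ⟨A, B, hA, hB, hd, hA0, hB0⟩ := hU hX
      obtain ⟨U, hUB, hU⟩ := ih B ⟨hB, A, hA, hA0, hd⟩ hB0
      exact ⟨U, hUB.trans hB, hU⟩

/-- A submodule of a module `M` of finite uniform dimension that contains a copy of `M` is
essential. If it missed `K ≠ 0`, then `K, e(K), e²(K), …` would be independent for the resulting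
injective endomorphism `e`. -/
theorem HasFiniteUniformDim.isEssential_of_injective (hfin : HasFiniteUniformDim R M)
    {N : Submodule R M} (f : M →ₗ[R] N) (hf : Function.Injective f) : IsEssential N := by
  intro K hK
  by_contra hne
  let e : Module.End R M := N.subtype ∘ₗ f
  have he : Function.Injective e := N.injective_subtype.comp hf
  obtain ⟨_, ⟨n, rfl⟩, hmin⟩ := hfin.wellFounded_down.has_min
    (Set.range fun n : ℕ => LinearMap.range (e ^ n)) ⟨_, 0, rfl⟩
  have hen : Function.Injective (e ^ n) := by
    rw [Module.End.coe_pow]; exact he.iterate n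
  refine hmin _ ⟨n + 1, rfl⟩ ⟨?_, K.map (e ^ n), LinearMap.map_le_range, ?_, ?_⟩
  · rintro _ ⟨x, rfl⟩
    exact ⟨e x, by rw [pow_succ]; rfl⟩
  · rwa [Ne, map_eq_bot_iff_of_injective hen]
  · rw [Submodule.disjoint_def]
    rintro _ ⟨k, hk, rfl⟩ ⟨m, hm⟩
    have hm' : (e ^ n) (e m) = (e ^ n) k := by rw [← hm, pow_succ]; rfl
    have hkN : k ∈ N ⊓ K := ⟨hen hm' ▸ (f m).2, hk⟩
    rw [hK, Submodule.mem_bot] at hkN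
    simp [hkN]

/-! ### The category `σ[M]` and singular modules -/

theorem InSigma.of_injective {N L : Type v} [AddCommGroup N] [Module R N] [AddCommGroup L]
    [Module R L] (hL : InSigma R M L) (i : N →ₗ[R] L) (hi : Function.Injective i) :
    InSigma R M N := by
  obtain ⟨X, _, _, hX, j, hj⟩ := hL
  exact ⟨X, _, _, hX, j ∘ₗ i, hj.comp hi⟩

theorem inSigma_finsupp (ι : Type v) : InSigma R M (ι →₀ M) :=
  ⟨ι →₀ M, _, _, ⟨ι, LinearMap.id, Function.surjective_id⟩, LinearMap.id, Function.injective_id⟩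

theorem inSigma_submodule (N : Submodule R M) : InSigma R M N :=
  (inSigma_finsupp PUnit).of_injective (Finsupp.lsingle PUnit.unit ∘ₗ N.subtype)
    ((Finsupp.single_injective _).comp N.injective_subtype)

theorem isNonSingular_iff : IsNonSingular R M M ↔
    ∀ (N : Type v) [AddCommGroup N] [Module R N] (φ : N →ₗ[R] M),
      IsSingular R M N → LinearMap.range φ = ⊥ := by
  rw [IsNonSingular, singularSubmodule, sSup_eq_bot]
  constructor
  · intro h N _ _ φ hN
    exact h _ ⟨N, _, _, φ, hN, rfl⟩
  · rintro h _ ⟨N, _, _, φ, hN, rfl⟩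
    exact h N φ hN

theorem isEssential_ker_of_isSingular (hproj : IsProjectiveInSigma R M M) {N : Type v}
    [AddCommGroup N] [Module R N] (hN : IsSingular R M N) (φ : N →ₗ[R] M)
    (g : M →ₗ[R] LinearMap.range φ) : IsEssential (LinearMap.ker g) := by
  obtain ⟨-, K, _, _, L, _, _, i, p, -, hL, -, hex, hp, hess⟩ := hN
  obtain ⟨h, rfl⟩ := hproj.2 L _ hL (inSigma_submodule _) (φ.rangeRestrict ∘ₗ p) g
    (φ.surjective_rangeRestrict.comp hp)
  refine (hess.comap h).mono ?_
  rintro x ⟨k, hk⟩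
  have : p (h x) = 0 := (hex _).2 ⟨k, hk⟩
  simp [this]

theorem IsNonSingular.eq_zero_of_isEssential_ker (hns : IsNonSingular R M M) {B : Submodule R M}
    (f : B →ₗ[R] M) (hf : IsEssential (LinearMap.ker f)) : f = 0 := by
  rw [isNonSingular_iff] at hns
  have hsing : IsSingular R M (LinearMap.range f) := by
    refine ⟨inSigma_submodule _, LinearMap.ker f, _, _, B, _, _, (LinearMap.ker f).subtype,
      f.rangeRestrict, (inSigma_submodule B).of_injective _ (Submodule.injective_subtype _),
      inSigma_submodule B, Submodule.injective_subtype _, ?_, f.surjective_rangeRestrict, ?_⟩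
    · rw [LinearMap.exact_iff, Submodule.range_subtype, LinearMap.ker_rangeRestrict]
    · rwa [Submodule.range_subtype]
  rw [← LinearMap.range_eq_bot]
  simpa using hns _ (LinearMap.range f).subtype hsing

/-! ### Semiprime projective modules -/

theorem exists_hom_apply_ne_zero (hproj : IsProjectiveInSigma R M M)
    (hs : IsSemiprimeModule R M) (N : Submodule R M) (hN : N ≠ ⊥) :
    ∃ g : M →ₗ[R] N, ∃ x ∈ N, g x ≠ 0 := by
  by_contra! hzero
  let K : Submodule R M := ⨆ s : Module.End R M, N.map s
  have hmap (s : Module.End R M) : N.map s ≤ K := le_iSup (fun s : Module.End R M => N.map s) s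
  have hNK : N ≤ K := by simpa using hmap LinearMap.id
  have hK : K.IsFullyInvariant := fun t => iSup_le fun s => by
    rw [← Submodule.map_le_iff_le_comap, ← Submodule.map_comp]
    exact hmap (t ∘ₗ s)
  -- `q` is the canonical epimorphism from the direct sum of copies of `N` onto its trace `K`.
  let q : (Module.End R M →₀ N) →ₗ[R] K := Finsupp.lsum ℕ fun s : Module.End R M =>
    (s ∘ₗ N.subtype).codRestrict K fun n => hmap s ⟨n, n.2, rfl⟩
  have hq : Function.Surjective q := by
    have : K ≤ (LinearMap.range q).map K.subtype := iSup_le fun s => by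
      rintro _ ⟨n, hn, rfl⟩
      exact ⟨_, ⟨Finsupp.single s ⟨n, hn⟩, rfl⟩, by simp [q]⟩
    intro k
    obtain ⟨_, ⟨l, rfl⟩, hl⟩ := this k.2
    exact ⟨l, Subtype.ext hl⟩
  have hL : InSigma R M (Module.End R M →₀ N) :=
    (inSigma_finsupp (Module.End R M)).of_injective (Finsupp.mapRange.linearMap N.subtype)
      (Finsupp.mapRange_injective _ (map_zero _) N.injective_subtype)
  refine hN (le_bot_iff.1 (hNK.trans (hs.2 K hK (iSup_le fun f => ?_))))
  obtain ⟨h, rfl⟩ := hproj.2 _ _ hL (inSigma_submodule K) q f hq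
  -- The coordinates of `h ∘ t` are morphisms `M → N`, so `h` vanishes on every `t(N)`.
  have hker : K ≤ LinearMap.ker h := iSup_le fun t => by
    rintro _ ⟨n, hn, rfl⟩
    exact Finsupp.ext fun s => hzero (Finsupp.lapply s ∘ₗ h ∘ₗ t) n hn
  rintro _ ⟨k, hk, rfl⟩
  have : h k = 0 := hker hk
  simp [this]

/-- The endomorphism ring of a semiprime module `M` that is projective in `σ[M]` is semiprime. -/
theorem exists_mul_mul_ne_zero (hproj : IsProjectiveInSigma R M M) (hs : IsSemiprimeModule R M)
    (a : Module.End R M) (ha : a ≠ 0) : ∃ s : Module.End R M, a * s * a ≠ 0 := by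
  obtain ⟨g, _, ⟨x, rfl⟩, hx⟩ := exists_hom_apply_ne_zero hproj hs (LinearMap.range a)
    (by rwa [Ne, LinearMap.range_eq_bot])
  obtain ⟨s, rfl⟩ := hproj.2 _ _ hproj.1 (inSigma_submodule _) a.rangeRestrict g
    a.surjective_rangeRestrict
  refine ⟨s, fun h0 => hx (Subtype.ext ?_)⟩
  exact LinearMap.congr_fun h0 x

/-! ### Non-singularity and chains of annihilators -/

theorem IsNonSingular.hasACCOnAnnihilators (hfin : HasFiniteUniformDim R M)
    (hns : IsNonSingular R M M) : HasACCOnAnnihilators R M := by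
  intro A hA
  obtain ⟨_, ⟨n, rfl⟩, hmax⟩ := hfin.wellFounded_up.has_min (Set.range A) ⟨_, 0, rfl⟩
  refine ⟨n, fun m hnm => le_antisymm (A.monotone hnm) fun x hx => ?_⟩
  obtain ⟨X, hX⟩ := hA n
  rw [hX, leftAnnihilator]
  simp only [Submodule.mem_iInf]
  intro f hf
  have hle : A n ≤ LinearMap.ker f := hX.le.trans (iInf₂_le f hf)
  have hzero := hns.eq_zero_of_isEssential_ker (f ∘ₗ (A m).subtype) fun Y hY => by
    by_contra hY0
    refine hmax (A m) ⟨m, rfl⟩ ⟨A.monotone hnm, Y.map (A m).subtype, Submodule.map_subtype_le _ _,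
      ?_, ?_⟩
    · rwa [Ne, map_eq_bot_iff_of_injective (A m).injective_subtype]
    · rw [Submodule.disjoint_def]
      rintro _ ⟨y, hy, rfl⟩ hyn
      have : y ∈ LinearMap.ker (f ∘ₗ (A m).subtype) ⊓ Y := ⟨hle hyn, hy⟩
      rw [hY, Submodule.mem_bot] at this
      simp [this]
  exact LinearMap.congr_fun hzero ⟨x, hx⟩

theorem HasACCOnAnnihilators.isNonSingular (hproj : IsProjectiveInSigma R M M)
    (hs : IsSemiprimeModule R M) (hacc : HasACCOnAnnihilators R M) : IsNonSingular R M M := by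
  rw [isNonSingular_iff]
  intro N _ _ φ hN
  by_contra hφ
  obtain ⟨g, y, -, hy⟩ := exists_hom_apply_ne_zero hproj hs _ hφ
  have hwf : WellFoundedGT {A : Submodule R M // ∃ X : Set (Module.End R M),
      A = leftAnnihilator X} := by
    rw [wellFoundedGT_iff_monotone_chain_condition]
    intro A
    obtain ⟨n, hn⟩ := hacc ⟨fun k => (A k).1, fun _ _ h => A.monotone h⟩ fun k => (A k).2
    exact ⟨n, fun m hm => Subtype.ext (hn m hm)⟩
  have hsingle (a : Module.End R M) : LinearMap.ker a = leftAnnihilator {a} := by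
    simp [leftAnnihilator]
  obtain ⟨_, ⟨a, ha, hess, rfl⟩, hmax⟩ := hwf.wf.has_min
    {A | ∃ a : Module.End R M, a ≠ 0 ∧ IsEssential (LinearMap.ker a) ∧
      A = ⟨LinearMap.ker a, {a}, hsingle a⟩}
    ⟨_, (LinearMap.range φ).subtype ∘ₗ g, fun h0 => hy (Subtype.ext (LinearMap.congr_fun h0 y)),
      (isEssential_ker_of_isSingular hproj hN φ g).mono (LinearMap.ker_le_ker_comp _ _), rfl⟩
  obtain ⟨s, hsa⟩ := exists_mul_mul_ne_zero hproj hs a ha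
  have hle : LinearMap.ker a ≤ LinearMap.ker (a * s * a) := LinearMap.ker_le_ker_comp a (a * s)
  have heq : LinearMap.ker (a * s * a) ≤ LinearMap.ker a := by
    by_contra hlt
    exact hmax _ ⟨a * s * a, hsa, hess.mono hle, rfl⟩ (lt_of_le_not_ge hle hlt)
  refine ha (LinearMap.range_eq_bot.1 ((hess.comap s) _ (eq_bot_iff.2 ?_)))
  rintro _ ⟨hx, x, rfl⟩
  exact heq (x := x) hx

/-! ### Essential submodules and copies of `M` -/

theorem exists_hom_uniform_disjoint_ker (hproj : IsProjectiveInSigma R M M)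
    (hs : IsSemiprimeModule R M) (hns : IsNonSingular R M M) {U : Submodule R M}
    (hU : IsUniformSubmodule U) : ∃ g : M →ₗ[R] U, Disjoint (LinearMap.ker g) U := by
  obtain ⟨g, x, hxU, hx⟩ := exists_hom_apply_ne_zero hproj hs U hU.1
  refine ⟨g, ?_⟩
  by_contra hd
  -- A nonzero submodule of a uniform module is essential in it.
  have hzero := hns.eq_zero_of_isEssential_ker (U.subtype ∘ₗ g ∘ₗ U.subtype) fun Y hY => by
    rw [← map_eq_bot_iff_of_injective U.injective_subtype]
    refine (hU.2 (LinearMap.ker g ⊓ U) _ inf_le_right (Submodule.map_subtype_le U Y)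
      ?_).resolve_left fun h => hd (disjoint_iff.2 h)
    rw [Submodule.disjoint_def]
    rintro _ hyg ⟨y, hy, rfl⟩
    have hgy : g y = 0 := hyg.1
    have : y ∈ LinearMap.ker (U.subtype ∘ₗ g ∘ₗ U.subtype) ⊓ Y := ⟨by simp [hgy], hy⟩
    rw [hY, Submodule.mem_bot] at this
    simp [this]
  exact hx (Subtype.ext (LinearMap.congr_fun hzero ⟨x, hxU⟩))

theorem exists_hom_disjoint_ker (hproj : IsProjectiveInSigma R M M)
    (hfin : HasFiniteUniformDim R M) (hs : IsSemiprimeModule R M) (hns : IsNonSingular R M M)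
    (X : Submodule R M) : ∃ f : M →ₗ[R] X, Disjoint (LinearMap.ker f) X := by
  induction X using hfin.wellFounded_down.induction with
  | _ X ih =>
    by_cases hX : X = ⊥
    · exact ⟨0, hX ▸ disjoint_bot_right⟩
    obtain ⟨U, hUX, hU⟩ := hfin.exists_uniform X hX
    obtain ⟨g, hg⟩ := exists_hom_uniform_disjoint_ker hproj hs hns hU
    obtain ⟨f, hf⟩ := ih (X ⊓ LinearMap.ker g)
      ⟨inf_le_left, U, hUX, hU.1, hg.symm.mono_right inf_le_right⟩
    refine ⟨Submodule.inclusion hUX ∘ₗ g + Submodule.inclusion inf_le_left ∘ₗ f, ?_⟩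
    rw [Submodule.disjoint_def]
    intro x hx hxX
    have hsum : (g x : M) + (f x : M) = 0 := congrArg Subtype.val hx
    -- `g x = - f x` lies in `U` and in `ker g`, hence vanishes.
    have hgx : (g x : M) = 0 := by
      refine Submodule.disjoint_def.1 hg _ ?_ (g x).2
      rw [eq_neg_of_add_eq_zero_left hsum]
      exact neg_mem (f x).2.2
    rw [hgx, zero_add] at hsum
    exact Submodule.disjoint_def.1 hf x (Subtype.ext hsum) ⟨hxX, Subtype.ext hgx⟩

theorem exists_add_eq_of_disjoint {K L : Submodule R M} (hd : Disjoint K L)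
    (f : M →ₗ[R] (K ⊔ L : Submodule R M)) :
    ∃ (g : M →ₗ[R] K) (h : M →ₗ[R] L), (K ⊔ L).subtype ∘ₗ f =
      K.subtype ∘ₗ g + L.subtype ∘ₗ h := by
  let c : (K × L) →ₗ[R] (K ⊔ L : Submodule R M) :=
    (Submodule.inclusion le_sup_left).coprod (Submodule.inclusion le_sup_right)
  have hc : Function.Bijective c := by
    constructor
    · rw [injective_iff_map_eq_zero]
      rintro ⟨k, l⟩ hkl
      have hsum : (k : M) + (l : M) = 0 := congrArg Subtype.val hkl
      have hk : (k : M) = 0 := by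
        refine Submodule.disjoint_def.1 hd _ k.2 ?_
        rw [eq_neg_of_add_eq_zero_left hsum]
        exact neg_mem l.2
      rw [hk, zero_add] at hsum
      exact Prod.ext (Subtype.ext hk) (Subtype.ext hsum)
    · rintro ⟨x, hx⟩
      obtain ⟨k, hk, l, hl, rfl⟩ := Submodule.mem_sup.1 hx
      exact ⟨(⟨k, hk⟩, ⟨l, hl⟩), rfl⟩
  let e := LinearEquiv.ofBijective c hc
  refine ⟨LinearMap.fst R K L ∘ₗ e.symm.toLinearMap ∘ₗ f,
    LinearMap.snd R K L ∘ₗ e.symm.toLinearMap ∘ₗ f, LinearMap.ext fun x => ?_⟩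
  exact congrArg Subtype.val (e.apply_symm_apply (f x)).symm

/-- If every essential submodule contains a copy of `M`, then for every submodule `K` there is
an injective endomorphism of `M` with essential image that is a sum of components in `K` and in
some `L` disjoint from `K`. -/
theorem exists_injective_add (hfin : HasFiniteUniformDim R M)
    (h3 : ∀ N : Submodule R M, IsEssential N → ∃ f : M →ₗ[R] N, Function.Injective f)
    (K : Submodule R M) : ∃ (L : Submodule R M) (g : M →ₗ[R] K) (h : M →ₗ[R] L),
      Disjoint K L ∧ Function.Injective (K.subtype ∘ₗ g + L.subtype ∘ₗ h) ∧
      IsEssential (LinearMap.range (K.subtype ∘ₗ g + L.subtype ∘ₗ h)) := by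
  obtain ⟨L, hd, hess⟩ := hfin.exists_complement K
  obtain ⟨f, hf⟩ := h3 _ hess
  obtain ⟨g, h, hgh⟩ := exists_add_eq_of_disjoint hd f
  have hinj : Function.Injective (K.subtype ∘ₗ g + L.subtype ∘ₗ h) :=
    hgh ▸ (K ⊔ L).injective_subtype.comp hf
  exact ⟨L, g, h, hd, hinj, hfin.isEssential_of_injective _
    ((LinearMap.injective_rangeRestrict_iff _).2 hinj)⟩

theorem isSemiprimeModule_of_essential_embedding (hfin : HasFiniteUniformDim R M)
    (h3 : ∀ N : Submodule R M, IsEssential N → ∃ f : M →ₗ[R] N, Function.Injective f) :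
    IsSemiprimeModule R M := by
  refine ⟨fun _ => bot_le, fun K hK hprod x hx => ?_⟩
  obtain ⟨L, g, h, hd, hinj, -⟩ := exists_injective_add hfin h3 K
  have hg : (g x : M) = 0 :=
    hprod (le_iSup (fun f : M →ₗ[R] K => K.map (K.subtype ∘ₗ f)) g ⟨x, hx, rfl⟩)
  have hmem : (K.subtype ∘ₗ g + L.subtype ∘ₗ h) x ∈ L := by simp [hg]
  exact hinj ((Submodule.disjoint_def.1 hd _ (hK _ hx) hmem).trans (map_zero _).symm)

theorem isNonSingular_of_essential_embedding (hproj : IsProjectiveInSigma R M M)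
    (hfin : HasFiniteUniformDim R M)
    (h3 : ∀ N : Submodule R M, IsEssential N → ∃ f : M →ₗ[R] N, Function.Injective f) :
    IsNonSingular R M M := by
  rw [isNonSingular_iff]
  intro N _ _ φ hN
  obtain ⟨L, g, h, hd, hinj, hess⟩ := exists_injective_add hfin h3 (LinearMap.range φ)
  refine IsEssential.map hinj hess (isEssential_ker_of_isSingular hproj hN φ g) _
    (disjoint_iff.1 (hd.symm.mono_left ?_))
  rintro _ ⟨x, hx, rfl⟩
  have hgx : g x = 0 := hx
  simp [hgx]

end GoldieModule

theorem theorem2p8 {R : Type*} [Ring R] {M : Type*} [AddCommGroup M] [Module R M]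
    (hproj : GoldieModule.IsProjectiveInSigma R M M)
    (hfin : GoldieModule.HasFiniteUniformDim R M) :
    List.TFAE [
      GoldieModule.IsSemiprimeModule R M ∧ GoldieModule.IsNonSingular R M M,
      GoldieModule.IsSemiprimeModule R M ∧ GoldieModule.HasACCOnAnnihilators R M,
      ∀ N : Submodule R M,
        GoldieModule.IsEssential N ↔ ∃ f : M →ₗ[R] N, Function.Injective f] := by
  tfae_have 1 → 2 := fun h => ⟨h.1, h.2.hasACCOnAnnihilators hfin⟩
  tfae_have 2 → 1 := fun h => ⟨h.1, h.2.isNonSingular hproj h.1⟩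
  tfae_have 1 → 3 := fun ⟨hs, hns⟩ N => by
    refine ⟨fun hN => ?_, fun ⟨f, hf⟩ => hfin.isEssential_of_injective f hf⟩
    obtain ⟨f, hf⟩ := GoldieModule.exists_hom_disjoint_ker hproj hfin hs hns N
    exact ⟨f, LinearMap.ker_eq_bot.1 (hN _ (disjoint_iff.1 hf.symm))⟩
  tfae_have 3 → 1 := fun h =>
    ⟨GoldieModule.isSemiprimeModule_of_essential_embedding hfin fun N => (h N).1,
      GoldieModule.isNonSingular_of_essential_embedding hproj hfin fun N => (h N).1⟩
  tfae_finish
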